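/- Let $G_1$ be an OE-group, i.e. a finitely generated residually finite group with less than two ends (equivalently, finite or one-ended), and let $H$ be a finite subgroup of $G_1$. Let $\mathrm{Out}(H)=\mathrm{Aut}(H)/\mathrm{Inn}(H)$. Denote by $\widetilde{\mathrm{Aut}}_{G_1}(H)$ the image in $\mathrm{Out}(H)$ of the group $\mathrm{Aut}_{G_1}(H)$ of automorphisms $\alpha$ of $G_1$ with $\alpha(H)=H$ (acting on $H$ by restriction), and by $\widetilde N_{G_1}(H)$ the image in $\mathrm{Out}(H)$ of the normalizer $N_{G_1}(H)$ (acting on $H$ by conjugation). For $f\in\mathrm{Aut}(H)$ let $\mathrm{HNN}(G_1,H,f,t)=\langle G_1,t \mid tht^{-1}=f(h)\ (h\in H)\rangle$ be the HNN-extension of $G_1$ with both associated subgroups equal to $H$. Suppose that $\widetilde{\mathrm{Aut}}_{G_1}(H)$ is contained in the center of $\mathrm{Out}(H)$. Then $\widetilde N_{G_1}(H)$ is a normal subgroup of $\mathrm{Out}(H)$, and the number of isomorphism classes (as abstract groups) of the groups $\mathrm{HNN}(G_1,H,f,t)$ with $f\in\mathrm{Aut}(H)$ is equal to $$\frac{n+d}{2},$$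 where $n=|\mathrm{Out}(H)/\widetilde N_{G_1}(H)|$ and $d$ is the number of elements of order at most $2$ (including the identity) in the quotient group $\mathrm{Out}(H)/\widetilde N_{G_1}(H)$. -/

import Mathlib

/-- An OE-group: a finitely generated residually finite group with less than two ends. The ends are
those of the Cayley graph with respect to a finite generating set; their number does not depend on
the generating set chosen. A finite group has no ends. -/
structure IsOEGroup (G : Type*) [Group G] : Prop where
  fg : Group.FG G
  residuallyFinite : Group.ResiduallyFinite G
  ends_lt_two : ∃ S : Finset G, Subgroup.closure (S : Set G) = ⊤ ∧
    Set.encard (SimpleGraph.mulCayley (S : Set G)).end < 2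

/-- The group of inner automorphisms of `H`, as a subgroup of `Aut(H)`. -/
def Inn (H : Type*) [Group H] : Subgroup (MulAut H) :=
  (MulAut.conj : H →* MulAut H).range

instance Inn.normal (H : Type*) [Group H] : (Inn H).Normal where
  conj_mem := by
    rintro _ ⟨h, rfl⟩ f
    refine ⟨f h, ?_⟩
    ext x
    simp [MulAut.conj_apply]

/-- The outer automorphism group `Out(H) = Aut(H) / Inn(H)`. -/
abbrev Out (H : Type*) [Group H] : Type _ := MulAut H ⧸ Inn H

section

variable {G : Type*} [Group G] (H : Subgroup G)

/-- `Aut_G(H)`: the automorphisms of `G` that leave `H` invariant. -/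
def autStabilizer : Subgroup (MulAut G) where
  carrier := {α | H.map α.toMonoidHom = H}
  one_mem' := by
    ext x
    simp [Subgroup.mem_map]
  mul_mem' := by
    intro α β hα hβ
    have h : (α * β).toMonoidHom = α.toMonoidHom.comp β.toMonoidHom := rfl
    simp only [Set.mem_ofPred_eq] at hα hβ ⊢
    rw [h, ← Subgroup.map_map, hβ, hα]
  inv_mem' := by
    intro α hα
    simp only [Set.mem_ofPred_eq] at hα ⊢
    conv_lhs => rw [← hα]
    rw [Subgroup.map_map]
    have h : (α⁻¹).toMonoidHom.comp α.toMonoidHom = MonoidHom.id G := by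
      ext x
      exact α.symm_apply_apply x
    rw [h, Subgroup.map_id]

/-- The image of `Aut_G(H)` in `Aut(H)` under restriction to `H`. -/
def autBar : Subgroup (MulAut H) where
  carrier := {β | ∃ α ∈ autStabilizer H, ∀ h : H, α (h : G) = (β h : G)}
  one_mem' := ⟨1, one_mem _, fun _ => rfl⟩
  mul_mem' := by
    rintro β γ ⟨a, ha, hβ⟩ ⟨b, hb, hγ⟩
    exact ⟨a * b, mul_mem ha hb, fun h => by simp [hγ, hβ]⟩
  inv_mem' := by
    rintro β ⟨a, ha, hβ⟩
    refine ⟨a⁻¹, inv_mem ha, fun h => ?_⟩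
    have h1 : a ((β⁻¹ h : H) : G) = (h : G) := by
      rw [hβ]
      exact congrArg Subtype.val (β.apply_symm_apply h)
    rw [← h1]
    exact a.symm_apply_apply _

/-- The natural image of `Aut_G(H)` in `Out(H)`. -/
def autTilde : Subgroup (Out H) :=
  (autBar H).map (QuotientGroup.mk' (Inn H))

/-- The natural image of the normalizer `N_G(H)`, acting on `H` by conjugation, in `Out(H)`. -/
def normalizerTilde : Subgroup (Out H) :=
  (H.normalizerMonoidHom.range).map (QuotientGroup.mk' (Inn H))

/-- Two automorphisms of `H` are equivalent when the HNN-extensions of `G` with both associated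
subgroups equal to `H` that they define are isomorphic as groups. -/
def hnnSetoid : Setoid (MulAut H) where
  r f f' := Nonempty (HNNExtension G H H f ≃* HNNExtension G H H f')
  iseqv :=
    { refl := fun _ => ⟨MulEquiv.refl _⟩
      symm := fun ⟨e⟩ => ⟨e.symm⟩
      trans := fun ⟨e⟩ ⟨e'⟩ => ⟨e.trans e'⟩ }

/-- The number of isomorphism classes of groups `HNN(G, H, f, t)` with `f ∈ Aut(H)`. -/
noncomputable def numHNNClasses : ℕ := Nat.card (Quotient (hnnSetoid H))

end

/-! ### Ends of Cayley graphs and almost invariant functions -/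

section Ends

open SimpleGraph CategoryTheory

/-! Let Q be the quotient of Out(H) by the image of the normalizer. The claim is that f and f' give
isomorphic HNN-extensions exactly when their images in Q are equal or mutually inverse;
`card_quotient_eq_of_iff_eq_or_eq_inv` then counts the orbits of inversion on Q. Sufficiency comes
from replacing t by t * n, with n in the normalizer, or by t⁻¹.

For necessity, an isomorphism e can be adjusted by inner automorphisms until it maps G onto G
(`exists_mulEquiv_of_eq`) and H onto H (`exists_mulEquiv_autStabilizer`), inducing some β on H. Then
e(t) normalizes H and acts on it as β f β⁻¹. In the target, a normalizing element acts, modulo the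
normalizer in G, as the power of f' given by its exponent sum (`exists_conj_eq`), which for e(t) is
±1 (`height_apply_t`). Centrality removes β (`outProj_conj`).

The adjustment of e uses the Bass–Serre tree. Its properties are all read off a crossed homomorphism
δ with values in ℤ[Γ/L], vanishing on the base group and sending t to the base edge. If a nonzero
multiple of δ is a coboundary on a subgroup, orbits are bounded and a vertex is fixed
(`exists_forall_conj_mem_of_coboundary`). On a finite group, averaging gives the coboundary; on an
infinite group with at most one end, each coefficient of δ is almost invariant, hence almost
constant, and the constants form the required cochain. -/

theorem SimpleGraph.exists_mem_end_of_infinite {V : Type*} (T : SimpleGraph V)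
    [Infinite V] [LocallyFinite T] [Fact T.Preconnected] (K : Finset V)
    (C : T.ComponentCompl K) (hC : C.supp.Infinite) :
    ∃ s ∈ T.end, s (Opposite.op K) = C := by
  -- An inverse system of nonempty finite sets is Mittag-Leffler, and infinite components are those
  -- in the eventual range, so `C` extends to a section.
  have hML : T.componentComplFunctor.IsMittagLeffler :=
    Functor.isMittagLeffler_of_exists_finite_range _ fun j =>
      ⟨j, 𝟙 j, by
        have : Finite (T.componentComplFunctor.obj j) := T.componentCompl_finite j.unop
        exact Set.toFinite _⟩
  have hne : ∀ j, Nonempty (T.componentComplFunctor.obj j) := fun j =>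
    T.componentCompl_nonempty_of_infinite j.unop
  have hfin : ∀ j, Finite (T.componentComplFunctor.obj j) := fun j =>
    T.componentCompl_finite j.unop
  have hne' : ∀ j, Nonempty (T.componentComplFunctor.toEventualRanges.obj j) :=
    fun j => Functor.toEventualRanges_nonempty _ hML j
  obtain ⟨s, hs⟩ := Functor.eval_section_surjective_of_surjective
    T.componentComplFunctor.toEventualRanges
    (Functor.surjective_toEventualRanges _ hML) (Opposite.op K)
    ⟨C, (T.infinite_iff_in_eventualRange (K := Opposite.op K) C).1 hC⟩
  refine ⟨_, (Functor.toEventualRangesSectionsEquiv _ s).2, ?_⟩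
  exact congrArg Subtype.val hs

variable {G : Type*} [Group G]

theorem mulCayley_preconnected {S : Set G} (hS : Subgroup.closure S = ⊤) :
    (mulCayley S).Preconnected := by
  have key : ∀ g : G, ∀ x : G, (mulCayley S).Reachable x (x * g) := by
    intro g
    have hg : g ∈ Subgroup.closure S := hS ▸ Subgroup.mem_top g
    induction hg using Subgroup.closure_induction with
    | mem s hs =>
      intro x
      by_cases h : x = x * s
      · rw [← h]
      · exact Adj.reachable ((mulCayley_adj' S _ _).2 ⟨h, s, hs, Or.inl rfl⟩)
    | one => intro x; simp
    | mul a b _ _ ha hb => intro x; rw [← mul_assoc]; exact (ha x).trans (hb _)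
    | inv a _ ha => intro x; simpa using (ha (x * a⁻¹)).symm
  intro u v
  simpa using key (u⁻¹ * v) u

noncomputable abbrev mulCayleyLocallyFinite (S : Finset G) :
    (mulCayley (S : Set G)).LocallyFinite := fun v => by
  refine Set.Finite.fintype (((S.finite_toSet.image (v * ·)).union
    (S.finite_toSet.image (v * ·⁻¹))).subset ?_)
  intro w hw
  obtain ⟨-, s, hs, h | h⟩ := (mulCayley_adj' _ _ _).1 hw
  · exact Or.inl ⟨s, hs, h⟩
  · exact Or.inr ⟨s, hs, by simp [h]⟩

/-- On the Cayley graph of a group with at most one end, an almost invariant function is constant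
outside a finite set. -/
theorem exists_finite_ne_of_encard_end_lt_two {S : Finset G}
    (hS : Subgroup.closure (S : Set G) = ⊤)
    (hE : (mulCayley (S : Set G)).end.encard < 2) {A : Type*} (F : G → A)
    (hF : ∀ s ∈ S, {g | F (g * s) ≠ F g}.Finite) : ∃ a, {g | F g ≠ a}.Finite := by
  classical
  rcases finite_or_infinite G with hG | hG
  · exact ⟨F 1, Set.toFinite _⟩
  have hpre : Fact (mulCayley (S : Set G)).Preconnected := ⟨mulCayley_preconnected hS⟩
  have := mulCayleyLocallyFinite S
  have hKfin : (⋃ s ∈ S, {g | F (g * s) ≠ F g}).Finite := S.finite_toSet.biUnion hF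
  set K : Finset G := hKfin.toFinset
  have hK : ∀ {g}, g ∉ K → ∀ s ∈ S, F (g * s) = F g := by
    intro g hg s hs
    by_contra h
    exact hg (by simp only [K, Set.Finite.mem_toFinset, Set.mem_iUnion]; exact ⟨s, hs, h⟩)
  let val : (mulCayley (S : Set G)).ComponentCompl (K : Set G) → A :=
    ComponentCompl.lift (fun g _ => F g) (by
      intro v w hv hw hvw
      obtain ⟨-, s, hs, h | h⟩ := (mulCayley_adj' _ _ _).1 hvw
      · rw [← h]; exact (hK hv s hs).symm
      · rw [h]; exact hK hw s hs)
  have hval : ∀ g (hg : g ∉ (K : Set G)), val (componentComplMk _ hg) = F g := fun _ _ => rfl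
  -- Two infinite complementary components would give two ends; so all but one component are finite,
  -- and `F` is constant on the remaining one.
  have huniq : ∀ C D : (mulCayley (S : Set G)).ComponentCompl (K : Set G),
      C.supp.Infinite → D.supp.Infinite → C = D := by
    intro C D hC hD
    obtain ⟨s, hs, rfl⟩ := exists_mem_end_of_infinite _ K C hC
    obtain ⟨s', hs', rfl⟩ := exists_mem_end_of_infinite _ K D hD
    have h1 : (mulCayley (S : Set G)).end.encard ≤ 1 := by
      rw [← one_add_one_eq_two] at hE
      exact ENat.lt_add_one_iff (by simp) |>.1 hE
    rw [Set.encard_le_one_iff.1 h1 s s' hs hs']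
  have hcover : ∀ g, g ∉ (K : Set G) →
      g ∈ ⋃ C : (mulCayley (S : Set G)).ComponentCompl (K : Set G), C.supp := fun g hg =>
    Set.mem_iUnion.2 ⟨_, componentComplMk_mem _ hg⟩
  have hfinC : Finite ((mulCayley (S : Set G)).ComponentCompl (K : Set G)) :=
    (mulCayley (S : Set G)).componentCompl_finite K
  have hex : ∃ C : (mulCayley (S : Set G)).ComponentCompl (K : Set G), C.supp.Infinite := by
    by_contra! h
    refine Set.infinite_univ (α := G) ((K.finite_toSet.union (Set.finite_iUnion h)).subset ?_)
    intro g _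
    by_cases hg : g ∈ (K : Set G)
    · exact Or.inl hg
    · exact Or.inr (hcover g hg)
  obtain ⟨C, hC⟩ := hex
  refine ⟨val C, (K.finite_toSet.union (Set.finite_iUnion
    (f := fun D : {D : (mulCayley (S : Set G)).ComponentCompl (K : Set G) // D ≠ C} => D.1.supp)
    fun D => ?_)).subset ?_⟩
  · by_contra h
    exact D.2 (huniq _ _ h hC)
  · intro g hg
    by_cases hgK : g ∈ (K : Set G)
    · exact Or.inl hgK
    · refine Or.inr (Set.mem_iUnion.2 ⟨⟨componentComplMk _ hgK, ?_⟩, componentComplMk_mem _ hgK⟩)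
      rintro rfl
      exact hg (hval g hgK).symm

end Ends

/-! ### Geodesics and fixed points in trees -/

namespace SimpleGraph

variable {V : Type*} {T : SimpleGraph V}

theorem IsTree.eq_of_dist_eq_add_one (hT : T.IsTree) {x a b m : V} (ha : T.Adj a m)
    (hb : T.Adj b m) (hxa : T.dist x m = T.dist x a + 1) (hxb : T.dist x m = T.dist x b + 1) :
    a = b := by
  obtain ⟨p, hp⟩ := (hT.connected x a).exists_walk_length_eq_dist
  obtain ⟨q, hq⟩ := (hT.connected x b).exists_walk_length_eq_dist
  have h1 : (p.concat ha).IsPath := Walk.isPath_of_length_eq_dist _ (by simp [hp, hxa])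
  have h2 : (q.concat hb).IsPath := Walk.isPath_of_length_eq_dist _ (by simp [hq, hxb])
  have h := (hT.existsUnique_path x m).unique h1 h2
  simpa using congrArg Walk.penultimate h

/-- A path that has started to move away from x never turns back: at a turning point two neighbours
would be closer to x, hence equal, and the path would repeat a vertex. -/
theorem IsTree.dist_eq_add_length (hT : T.IsTree) {x m y : V} (p : T.Walk m y) :
    ∀ {u : V}, p.IsPath → T.Adj u m → u ∉ p.support → T.dist x m = T.dist x u + 1 →
      T.dist x y = T.dist x m + p.length := by
  induction p with
  | nil => intros; simp
  | @cons m n y h q ih =>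
    intro u hp hum hu hd
    rw [Walk.cons_isPath_iff] at hp
    have hn : T.dist x n = T.dist x m + 1 := by
      rcases hT.dist_eq_dist_add_one_of_adj x h with h' | h'
      · have := hT.eq_of_dist_eq_add_one hum h.symm hd h'
        subst this
        simp at hu
      · exact h'
    rw [ih hp.1 h hp.2 hn, hn, Walk.length_cons]
    ring

/-- Distance to x is convex along the path from u to y, so its second vertex works; nonadjacency
keeps that vertex different from y. -/
theorem IsTree.exists_dist_lt_max (hT : T.IsTree) {u y : V} (hne : u ≠ y) (hadj : ¬ T.Adj u y) :
    ∃ m, ∀ x, T.dist x m < max (T.dist x u) (T.dist x y) := by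
  obtain ⟨p, hp, -⟩ := hT.existsUnique_path u y
  cases p with
  | nil => exact absurd rfl hne
  | @cons _ m _ h q =>
    rw [Walk.cons_isPath_iff] at hp
    refine ⟨m, fun x => ?_⟩
    rcases hT.dist_eq_dist_add_one_of_adj x h with h' | h'
    · exact lt_max_of_lt_left (by omega)
    · refine lt_max_of_lt_right ?_
      rw [hT.dist_eq_add_length q hp.1 h hp.2 h']
      have : 0 < q.length := by
        rw [Nat.pos_iff_ne_zero]
        intro h0
        exact hadj (Walk.eq_of_length_eq_zero h0 ▸ h)
      omega

variable {P : Type*} [Group P] [MulAction P V]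

theorem dist_smul_smul (hT : T.Connected)
    (hact : ∀ (g : P) (u v : V), T.Adj u v → T.Adj (g • u) (g • v)) (g : P) (u v : V) :
    T.dist (g • u) (g • v) = T.dist u v := by
  have key : ∀ (g : P) (u v : V), T.dist (g • u) (g • v) ≤ T.dist u v := by
    intro g u v
    obtain ⟨p, hp⟩ := (hT u v).exists_walk_length_eq_dist
    let φ : T →g T := ⟨fun w => g • w, fun h => hact g _ _ h⟩
    rw [← hp, ← Walk.length_map φ p]
    exact dist_le (p.map φ)
  refine le_antisymm (key g u v) ?_
  simpa using key g⁻¹ (g • u) (g • v)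

/-- A centre of a bounded orbit is fixed: if u minimizes the radius and h moves u, a vertex strictly
between u and h • u has smaller radius. -/
theorem IsTree.exists_forall_smul_eq (hT : T.IsTree)
    (hact : ∀ (g : P) (u v : V), T.Adj u v → T.Adj (g • u) (g • v))
    (hinv : ∀ (g : P) (u : V), ¬ T.Adj u (g • u)) (v : V) (C : ℕ)
    (hb : ∀ g : P, T.dist v (g • v) ≤ C) : ∃ u : V, ∀ g : P, g • u = u := by
  classical
  have hex : ∃ n, ∃ u, ∀ g : P, T.dist (g • v) u ≤ n :=
    ⟨C, v, fun g => by rw [dist_comm]; exact hb g⟩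
  obtain ⟨u, hu⟩ := Nat.find_spec hex
  refine ⟨u, fun h => ?_⟩
  by_contra hne
  obtain ⟨m, hm⟩ := hT.exists_dist_lt_max (Ne.symm hne) (hinv h u)
  have hu' : ∀ g : P, T.dist (g • v) (h • u) ≤ Nat.find hex := by
    intro g
    have := hu (h⁻¹ * g)
    rwa [← dist_smul_smul hT.connected hact h, smul_smul, mul_inv_cancel_left] at this
  have hlt : ∀ g : P, T.dist (g • v) m < Nat.find hex := fun g =>
    (hm _).trans_le (max_le (hu g) (hu' g))
  have hpos := (Nat.zero_le _).trans_lt (hlt 1)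
  exact Nat.find_min hex (m := Nat.find hex - 1) (by omega)
    ⟨m, fun g => by have := hlt g; omega⟩

/-- The first vertex on the geodesic between two fixed vertices of a tree is fixed. -/
theorem IsTree.exists_adj_dist_eq (hT : T.IsTree)
    (hact : ∀ (g : P) (u v : V), T.Adj u v → T.Adj (g • u) (g • v)) {u y : V} (hne : u ≠ y) :
    ∃ m, T.Adj u m ∧ T.dist u y = T.dist m y + 1 ∧
      ∀ g : P, g • u = u → g • y = y → g • m = m := by
  obtain ⟨p, hp⟩ := (hT.connected u y).exists_walk_length_eq_dist
  cases p with
  | nil => exact absurd rfl hne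
  | @cons _ m _ h q =>
    rw [Walk.length_cons] at hp
    have hd : T.dist u y = T.dist m y + 1 := by
      rcases hT.dist_eq_dist_add_one_of_adj y h with h' | h'
      · rwa [dist_comm, T.dist_comm (v := m)] at h'
      · have := dist_le q
        rw [dist_comm, T.dist_comm (v := u)] at h'
        omega
    refine ⟨m, h, hd, fun g hu hy => ?_⟩
    have h1 : T.Adj (g • m) u := by
      have := hact g _ _ h
      rw [hu] at this
      exact this.symm
    refine hT.eq_of_dist_eq_add_one (x := y) h1 h.symm ?_ ?_
    · rw [dist_comm, hd, T.dist_comm (u := y), ← dist_smul_smul hT.connected hact g m y, hy]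
    · rw [dist_comm, hd, T.dist_comm (u := y)]

end SimpleGraph

-- The Bass–Serre tree of a splitting cocycle

attribute [local instance] Finsupp.comapSMul Finsupp.comapMulAction
  Finsupp.comapDistribMulAction

/-- The data of a splitting of `Γ` as an HNN-extension with base `K`, both associated subgroups
equal to `L` and stable letter `t`, seen through the crossed homomorphism that counts, with signs,
the edges crossed in the Bass–Serre tree on the way from the base vertex to its translates. -/
structure SplittingCocycle {Γ : Type*} [Group Γ] (K L : Subgroup Γ) (t : Γ) where
  toFun : Γ → (Γ ⧸ L →₀ ℤ)
  map_mul : ∀ x y, toFun (x * y) = toFun x + x • toFun y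
  map_of_mem : ∀ k ∈ K, toFun k = 0
  map_t : toFun t = Finsupp.single ((1 : Γ) : Γ ⧸ L) 1
  le : L ≤ K
  conj_mem : ∀ l ∈ L, t * l * t⁻¹ ∈ L
  conj_mem' : ∀ l ∈ L, t⁻¹ * l * t ∈ L
  closure_eq_top : Subgroup.closure (insert t (K : Set Γ)) = ⊤

namespace SplittingCocycle

open SimpleGraph

variable {Γ : Type*} [Group Γ] {K L : Subgroup Γ} {t : Γ} (δ : SplittingCocycle K L t)
include δ

theorem map_one : δ.toFun 1 = 0 := δ.map_of_mem 1 K.one_mem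

theorem map_mul_of_mem (x : Γ) {k : Γ} (hk : k ∈ K) : δ.toFun (x * k) = δ.toFun x := by
  rw [δ.map_mul, δ.map_of_mem k hk, smul_zero, add_zero]

theorem map_mul_t (x : Γ) :
    δ.toFun (x * t) = δ.toFun x + Finsupp.single (x : Γ ⧸ L) 1 := by
  rw [δ.map_mul, δ.map_t, Finsupp.comapSMul_single, MulAction.Quotient.smul_coe, smul_eq_mul,
    mul_one]

/-- The crossed homomorphism as a function on the vertices of the tree. -/
def pos (v : Γ ⧸ K) : Γ ⧸ L →₀ ℤ :=
  Quotient.liftOn' v δ.toFun fun a b h => by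
    rw [QuotientGroup.leftRel_apply] at h
    rw [← δ.map_mul_of_mem a h, mul_inv_cancel_left]

theorem pos_mk (x : Γ) : δ.pos (x : Γ ⧸ K) = δ.toFun x := rfl

/-- The Bass–Serre tree. -/
def tree : SimpleGraph (Γ ⧸ K) where
  Adj u v := ∃ g : Γ, (u = (g : Γ ⧸ K) ∧ v = ((g * t : Γ) : Γ ⧸ K)) ∨
    (v = (g : Γ ⧸ K) ∧ u = ((g * t : Γ) : Γ ⧸ K))
  symm := ⟨by rintro u v ⟨g, h | h⟩ <;> exact ⟨g, by tauto⟩⟩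
  loopless := ⟨by
    rintro u ⟨g, ⟨h, h'⟩ | ⟨h, h'⟩⟩ <;>
    · have := congrArg δ.pos (h.symm.trans h')
      rw [pos_mk, pos_mk, map_mul_t] at this
      simp at this⟩

theorem adj_mul_t (g : Γ) : δ.tree.Adj (g : Γ ⧸ K) ((g * t : Γ) : Γ ⧸ K) :=
  ⟨g, Or.inl ⟨rfl, rfl⟩⟩

theorem adj_smul (g : Γ) (u v : Γ ⧸ K) (h : δ.tree.Adj u v) :
    δ.tree.Adj (g • u) (g • v) := by
  obtain ⟨x, ⟨rfl, rfl⟩ | ⟨rfl, rfl⟩⟩ := h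
  · rw [MulAction.Quotient.smul_coe, MulAction.Quotient.smul_coe, smul_eq_mul, smul_eq_mul,
      ← mul_assoc]
    exact δ.adj_mul_t _
  · rw [MulAction.Quotient.smul_coe, MulAction.Quotient.smul_coe, smul_eq_mul, smul_eq_mul,
      ← mul_assoc]
    exact (δ.adj_mul_t _).symm

theorem edge_eq_of_mk_eq {g g' : Γ} (h : (g : Γ ⧸ L) = g') :
    (s((g : Γ ⧸ K), ((g * t : Γ) : Γ ⧸ K)) : Sym2 (Γ ⧸ K)) =
      s((g' : Γ ⧸ K), ((g' * t : Γ) : Γ ⧸ K)) := by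
  rw [QuotientGroup.eq] at h
  have h1 : (g : Γ ⧸ K) = g' := QuotientGroup.eq.2 (δ.le h)
  have h2 : ((g * t : Γ) : Γ ⧸ K) = ((g' * t : Γ) : Γ ⧸ K) := by
    rw [QuotientGroup.eq]
    have := δ.le (δ.conj_mem' _ h)
    simpa [mul_assoc] using this
  rw [h1, h2]

/-- Crossing an edge changes only the coefficient indexed by that edge. As crossing it does change
this coefficient by one, every edge is a bridge. -/
theorem pos_apply_eq_of_notMem_edges (g : Γ) {u v : Γ ⧸ K} (p : δ.tree.Walk u v)
    (hp : s((g : Γ ⧸ K), ((g * t : Γ) : Γ ⧸ K)) ∉ p.edges) :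
    δ.pos v (g : Γ ⧸ L) = δ.pos u (g : Γ ⧸ L) := by
  induction p with
  | nil => rfl
  | @cons a b c h q ih =>
    rw [Walk.edges_cons, List.mem_cons, not_or] at hp
    rw [ih hp.2]
    obtain ⟨x, ⟨rfl, rfl⟩ | ⟨rfl, rfl⟩⟩ := h
    · have : (x : Γ ⧸ L) ≠ g := fun hx => hp.1 (δ.edge_eq_of_mk_eq hx).symm
      rw [pos_mk, pos_mk, map_mul_t, Finsupp.add_apply, Finsupp.single_eq_of_ne' this, add_zero]
    · have : (x : Γ ⧸ L) ≠ g := fun hx => hp.1 (by rw [← δ.edge_eq_of_mk_eq hx, Sym2.eq_swap])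
      rw [pos_mk, pos_mk, map_mul_t, Finsupp.add_apply, Finsupp.single_eq_of_ne' this, add_zero]

theorem isAcyclic : δ.tree.IsAcyclic := by
  rw [isAcyclic_iff_forall_adj_isBridge]
  intro v w h
  rw [isBridge_iff_forall_walk_mem_edges]
  intro p
  by_contra hp
  obtain ⟨x, ⟨rfl, rfl⟩ | ⟨rfl, rfl⟩⟩ := h
  · have := δ.pos_apply_eq_of_notMem_edges x p hp
    rw [pos_mk, pos_mk, map_mul_t] at this
    simp at this
  · rw [Sym2.eq_swap] at hp
    have := δ.pos_apply_eq_of_notMem_edges x p hp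
    rw [pos_mk, pos_mk, map_mul_t] at this
    simp at this

theorem connected : δ.tree.Connected := by
  have key : ∀ g x : Γ, δ.tree.Reachable (x : Γ ⧸ K) ((x * g : Γ) : Γ ⧸ K) := by
    intro g
    have hg : g ∈ Subgroup.closure (insert t (K : Set Γ)) :=
      δ.closure_eq_top ▸ Subgroup.mem_top g
    induction hg using Subgroup.closure_induction with
    | mem s hs =>
      intro x
      rcases hs with rfl | hs
      · exact (δ.adj_mul_t x).reachable
      · have : ((x * s : Γ) : Γ ⧸ K) = x := by
          rw [eq_comm, QuotientGroup.eq]; simpa using hs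
        rw [this]
    | one => intro x; simp
    | mul a b _ _ ha hb => intro x; rw [← mul_assoc]; exact (ha x).trans (hb _)
    | inv a _ ha => intro x; simpa using (ha (x * a⁻¹)).symm
  refine Connected.mk ?_
  intro u v
  induction u using QuotientGroup.induction_on with | _ u
  induction v using QuotientGroup.induction_on with | _ v
  simpa using key (u⁻¹ * v) u

theorem isTree : δ.tree.IsTree := ⟨δ.connected, δ.isAcyclic⟩

/-- A trail crosses each edge at most once, so the contributions ±1 of its edges cannot cancel. -/
theorem length_le_card_support {u v : Γ ⧸ K} (p : δ.tree.Walk u v) (hp : p.IsTrail) :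
    p.length ≤ (δ.pos v - δ.pos u).support.card := by
  classical
  induction p with
  | nil => simp
  | @cons a b c h q ih =>
    rw [Walk.isTrail_cons] at hp
    have key : ∀ x : Γ, ∀ ε : ℤ, ε ≠ 0 → s((x : Γ ⧸ K), ((x * t : Γ) : Γ ⧸ K)) ∉ q.edges →
        δ.pos b - δ.pos a = Finsupp.single (x : Γ ⧸ L) ε →
        (Walk.cons h q).length ≤ (δ.pos c - δ.pos a).support.card := by
      intro x ε hε hx hab
      have h0 : (x : Γ ⧸ L) ∉ (δ.pos c - δ.pos b).support := by
        rw [Finsupp.notMem_support_iff, Finsupp.sub_apply,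
          δ.pos_apply_eq_of_notMem_edges x q hx, sub_self]
      have hsub : insert (x : Γ ⧸ L) (δ.pos c - δ.pos b).support ⊆
          (δ.pos c - δ.pos a).support := by
        have hca : δ.pos c - δ.pos a = (δ.pos c - δ.pos b) + Finsupp.single (x : Γ ⧸ L) ε := by
          rw [← hab]; abel
        intro e he
        rw [hca, Finsupp.mem_support_iff, Finsupp.add_apply]
        by_cases hex : e = x
        · subst hex
          rw [Finsupp.notMem_support_iff.1 h0]
          simpa using hε
        · rw [Finsupp.single_eq_of_ne hex, add_zero]
          exact Finsupp.mem_support_iff.1 ((Finset.mem_insert.1 he).resolve_left hex)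
      refine le_trans ?_ (Finset.card_le_card hsub)
      rw [Finset.card_insert_of_notMem h0, Walk.length_cons]
      exact Nat.succ_le_succ (ih hp.1)
    have h' := h
    obtain ⟨x, ⟨h1, h2⟩ | ⟨h1, h2⟩⟩ := h'
    · refine key x 1 one_ne_zero ?_ ?_
      · rw [← h1, ← h2]; exact hp.2
      · rw [h1, h2, pos_mk, pos_mk, map_mul_t]; abel
    · refine key x (-1) (by simp) ?_ ?_
      · rw [← h1, ← h2, Sym2.eq_swap]; exact hp.2
      · rw [h1, h2, pos_mk, pos_mk, map_mul_t, Finsupp.single_neg]; abel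

theorem dist_le_card_support (x : Γ) :
    δ.tree.dist ((1 : Γ) : Γ ⧸ K) (x : Γ ⧸ K) ≤ (δ.toFun x).support.card := by
  obtain ⟨p, hp, hd⟩ := (δ.connected ((1 : Γ) : Γ ⧸ K) (x : Γ ⧸ K)).exists_path_of_dist
  have := δ.length_le_card_support p hp.isTrail
  rwa [pos_mk, pos_mk, map_one, sub_zero, hd] at this

/-- The exponent sum of the stable letter. -/
def height : Γ →* Multiplicative ℤ where
  toFun x := Multiplicative.ofAdd ((δ.toFun x).sum fun _ n => n)
  map_one' := by rw [map_one]; rfl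
  map_mul' x y := by
    rw [δ.map_mul, Finsupp.sum_add_index' (fun _ => rfl) (fun _ _ _ => rfl), ofAdd_add,
      Finsupp.comapSMul_def, Finsupp.sum_mapDomain_index (fun _ => rfl) (fun _ _ _ => rfl)]

theorem height_of_mem {k : Γ} (hk : k ∈ K) : δ.height k = 1 := by
  change Multiplicative.ofAdd ((δ.toFun k).sum fun _ n => n) = 1
  rw [δ.map_of_mem k hk]; rfl

theorem height_t : δ.height t = Multiplicative.ofAdd 1 := by
  change Multiplicative.ofAdd ((δ.toFun t).sum fun _ n => n) = _
  rw [δ.map_t, Finsupp.sum_single_index rfl]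

theorem height_eq_of_mk_eq {x y : Γ} (h : (x : Γ ⧸ K) = y) : δ.height x = δ.height y := by
  rw [QuotientGroup.eq] at h
  rw [← mul_inv_cancel_left x y, _root_.map_mul, δ.height_of_mem h, mul_one]

/-- The exponent sum is well defined on vertices and differs by one between neighbours. -/
theorem not_adj_smul {g : Γ} (hg : δ.height g = 1) (u : Γ ⧸ K) : ¬ δ.tree.Adj u (g • u) := by
  induction u using QuotientGroup.induction_on with | _ u
  rintro ⟨x, ⟨h, h'⟩ | ⟨h, h'⟩⟩ <;> rw [MulAction.Quotient.smul_coe, smul_eq_mul] at * <;>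
  · have e := δ.height_eq_of_mk_eq h
    have e' := δ.height_eq_of_mk_eq h'
    simp only [_root_.map_mul, hg, one_mul, height_t] at e e'
    rw [e] at e'
    simp at e'

/-- A group fixing two adjacent vertices lies in an edge group. -/
theorem mem_of_smul_eq {g x : Γ} (h1 : x • (g : Γ ⧸ K) = g)
    (h2 : x • ((g * t : Γ) : Γ ⧸ K) = ((g * t : Γ) : Γ ⧸ K)) : g⁻¹ * x * g ∈ L := by
  have e1 := congrArg δ.pos h1
  have e2 := congrArg δ.pos h2
  rw [MulAction.Quotient.smul_coe, smul_eq_mul, pos_mk, pos_mk] at e1 e2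
  rw [← mul_assoc, map_mul_t, map_mul_t, e1, add_right_inj] at e2
  have := Finsupp.single_left_injective one_ne_zero e2
  rw [eq_comm, QuotientGroup.eq] at this
  simpa [mul_assoc] using this

/-- As t normalizes L, both orientations of the edge can be described by a representative g of the
endpoint u. -/
theorem mem_of_adj_of_smul_eq {u m : Γ ⧸ K} (h : δ.tree.Adj u m) :
    ∃ g : Γ, (u = (g : Γ ⧸ K) ∧ m = ((g * t : Γ) : Γ ⧸ K) ∨
        u = (g : Γ ⧸ K) ∧ m = ((g * t⁻¹ : Γ) : Γ ⧸ K)) ∧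
      ∀ x : Γ, x • u = u → x • m = m → g⁻¹ * x * g ∈ L := by
  obtain ⟨g, ⟨rfl, rfl⟩ | ⟨rfl, rfl⟩⟩ := h
  · exact ⟨g, Or.inl ⟨rfl, rfl⟩, fun x h1 h2 => δ.mem_of_smul_eq h1 h2⟩
  · refine ⟨g * t, Or.inr ⟨rfl, by simp⟩, fun x h1 h2 => ?_⟩
    have := δ.conj_mem' _ (δ.mem_of_smul_eq h2 h1)
    simpa [mul_assoc] using this

end SplittingCocycle

/-! ### Subgroups fixing a vertex, and the normalizer of the edge group -/

namespace SplittingCocycle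

open SimpleGraph

variable {Γ : Type*} [Group Γ] {K L : Subgroup Γ} {t : Γ} (δ : SplittingCocycle K L t)

theorem smul_apply (x : Γ) (f : Γ ⧸ L →₀ ℤ) (e : Γ ⧸ L) : (x • f) e = f (x⁻¹ • e) :=
  Finsupp.comapSMul_apply x f e

theorem finite_setOf_inv_smul_eq [Finite L] (e e' : Γ ⧸ L) : {x : Γ | x⁻¹ • e = e'}.Finite := by
  induction e using QuotientGroup.induction_on with | _ a
  induction e' using QuotientGroup.induction_on with | _ b
  refine ((Set.toFinite (L : Set Γ)).image fun l => a * l * b⁻¹).subset ?_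
  intro x hx
  have hx' : ((x⁻¹ * a : Γ) : Γ ⧸ L) = b := hx
  rw [QuotientGroup.eq] at hx'
  exact ⟨_, hx', by simp [mul_assoc]⟩

include δ

/-- If a multiple of the restriction of the cocycle to a subgroup is a coboundary, then the
subgroup is conjugate into the base group. -/
theorem exists_forall_conj_mem_of_coboundary (P : Subgroup Γ) {n : ℤ} (hn : n ≠ 0)
    (c : Γ ⧸ L →₀ ℤ) (hc : ∀ g ∈ P, n • δ.toFun g = c - g • c) :
    ∃ x : Γ, ∀ g ∈ P, x⁻¹ * g * x ∈ K := by
  classical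
  -- Translation preserves the sum of coefficients, so a coboundary has sum zero.
  have hheight : ∀ g ∈ P, δ.height g = 1 := by
    intro g hg
    have h1 := congrArg (fun f : Γ ⧸ L →₀ ℤ => f.sum fun _ m => m) (hc g hg)
    have h2 : ((g • c).sum fun _ m => m) = c.sum fun _ m => m := by
      rw [Finsupp.comapSMul_def, Finsupp.sum_mapDomain_index (fun _ => rfl) (fun _ _ _ => rfl)]
    rw [Finsupp.sum_sub_index (fun _ _ _ => rfl), h2, sub_self,
      Finsupp.sum_smul_index (fun _ => rfl)] at h1
    simp only [← smul_eq_mul] at h1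
    rw [← Finsupp.smul_sum, smul_eq_mul] at h1
    exact congrArg Multiplicative.ofAdd ((mul_eq_zero.1 h1).resolve_left hn)
  obtain ⟨u, hu⟩ := δ.isTree.exists_forall_smul_eq (P := P) (fun g => δ.adj_smul g)
    (fun g => δ.not_adj_smul (hheight g g.2)) ((1 : Γ) : Γ ⧸ K)
    (c.support.card + c.support.card) (by
      intro g
      have h0 : g • ((1 : Γ) : Γ ⧸ K) = ((g : Γ) : Γ ⧸ K) := by
        change ((g : Γ) • ((1 : Γ) : Γ ⧸ K)) = _
        rw [MulAction.Quotient.smul_coe, smul_eq_mul, mul_one]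
      rw [h0]
      refine (δ.dist_le_card_support _).trans ?_
      have h1 : (δ.toFun g).support = (c - (g : Γ) • c).support := by
        rw [← hc g g.2]
        ext e
        simp [hn]
      rw [h1]
      refine (Finset.card_le_card Finsupp.support_sub).trans
        ((Finset.card_union_le _ _).trans (Nat.add_le_add_left ?_ _))
      rw [Finsupp.comapSMul_def]
      exact (Finset.card_le_card Finsupp.mapDomain_support).trans Finset.card_image_le)
  induction u using QuotientGroup.induction_on with | _ x
  refine ⟨x, fun g hg => ?_⟩
  have h := hu ⟨g, hg⟩
  change ((g * x : Γ) : Γ ⧸ K) = x at h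
  rw [eq_comm, QuotientGroup.eq] at h
  simpa [mul_assoc] using h

/-- Averaging: summing δ(gy) = δ(g) + g • δ(y) over y exhibits |G| • δ as a coboundary, which is why
multiples of δ are allowed above. -/
theorem exists_forall_conj_mem_of_finite {G : Type*} [Group G] [Finite G] (ρ : G →* Γ) :
    ∃ x : Γ, ∀ g, x⁻¹ * ρ g * x ∈ K := by
  have := Fintype.ofFinite G
  obtain ⟨x, hx⟩ := δ.exists_forall_conj_mem_of_coboundary ρ.range
    (n := Fintype.card G) (by exact_mod_cast Fintype.card_ne_zero) (∑ y : G, δ.toFun (ρ y)) (by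
      rintro _ ⟨g, rfl⟩
      rw [eq_sub_iff_add_eq, Finset.smul_sum]
      conv_rhs => rw [← Equiv.sum_comp (Equiv.mulLeft g)]
      simp only [Equiv.coe_mulLeft, _root_.map_mul, δ.map_mul]
      rw [Finset.sum_add_distrib, Finset.sum_const, Finset.card_univ, natCast_zsmul])
  exact ⟨x, fun g => hx _ ⟨g, rfl⟩⟩

/-- A finitely generated group with at most one end that embeds in an HNN-extension with finite
associated subgroups is conjugate into the base group. -/
theorem exists_forall_conj_mem_of_infinite [Finite L] {G : Type*} [Group G] [Infinite G]
    {S : Finset G} (hS : Subgroup.closure (S : Set G) = ⊤)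
    (hE : (mulCayley (S : Set G)).end.encard < 2) (ρ : G →* Γ) (hρ : Function.Injective ρ) :
    ∃ x : Γ, ∀ g, x⁻¹ * ρ g * x ∈ K := by
  classical
  have hmul : ∀ g s e, δ.toFun (ρ (g * s)) e = δ.toFun (ρ g) e + δ.toFun (ρ s) ((ρ g)⁻¹ • e) := by
    intro g s e
    rw [_root_.map_mul, δ.map_mul, Finsupp.add_apply, smul_apply]
  -- Right multiplication by s changes the coefficient at e by that of δ(s) at g⁻¹e, nonzero for
  -- finitely many g since edge stabilizers are finite.
  have hconst : ∀ e, ∃ a, {g | δ.toFun (ρ g) e ≠ a}.Finite := by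
    intro e
    refine exists_finite_ne_of_encard_end_lt_two hS hE (fun g => δ.toFun (ρ g) e) fun s _ => ?_
    have : {g | δ.toFun (ρ (g * s)) e ≠ δ.toFun (ρ g) e} ⊆
        ⋃ e' ∈ (δ.toFun (ρ s)).support, ρ ⁻¹' {x : Γ | x⁻¹ • e = e'} := by
      intro g hg
      simp only [Set.mem_ofPred_eq, hmul, ne_eq, add_eq_left] at hg
      simp only [Set.mem_iUnion]
      exact ⟨_, Finsupp.mem_support_iff.2 hg, rfl⟩
    refine Set.Finite.subset (Set.Finite.biUnion (Finset.finite_toSet _) fun e' _ => ?_) this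
    exact (finite_setOf_inv_smul_eq e e').preimage hρ.injOn
  choose c hc using hconst
  let A : Γ ⧸ L → Set G := fun e => {g | δ.toFun (ρ g) e ≠ c e}
  -- Evaluate the cocycle identity at a generic x; δ is then the coboundary of `c`, and only
  -- finiteness of the support of `c` is missing.
  have hcg : ∀ g e, c e = δ.toFun (ρ g) e + c ((ρ g)⁻¹ • e) := by
    intro g e
    have hfin : ((g * ·) ⁻¹' A e ∪ A ((ρ g)⁻¹ • e)).Finite :=
      ((hc e).preimage (mul_right_injective g).injOn).union (hc _)
    obtain ⟨x, hx⟩ := hfin.infinite_compl.nonempty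
    simp only [A, Set.mem_compl_iff, Set.mem_union, Set.mem_preimage, Set.mem_ofPred_eq, not_or,
      not_not] at hx
    rw [← hx.1, ← hx.2, hmul]
  have hA : ∀ g e, (A (ρ g • e)).ncard = (A e).ncard := by
    intro g e
    have : A (ρ g • e) = (g * ·) '' A e := by
      ext x
      constructor
      · intro hx
        refine ⟨g⁻¹ * x, ?_, mul_inv_cancel_left _ _⟩
        intro h
        apply hx
        have := hmul g (g⁻¹ * x) (ρ g • e)
        rw [mul_inv_cancel_left, inv_smul_smul, h] at this
        rw [this, hcg g (ρ g • e), inv_smul_smul]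
      · rintro ⟨y, hy, rfl⟩ h
        apply hy
        rw [hmul, hcg g (ρ g • e), inv_smul_smul] at h
        exact add_left_cancel h
    rw [this, Set.ncard_image_of_injective _ (mul_right_injective g)]
  let E₀ : Finset (Γ ⧸ L) := S.biUnion fun s => (δ.toFun (ρ s)).support
  -- Off the translates of `E₀` no generator changes the coefficient, which therefore keeps its
  -- value 0 at the identity.
  have hE₀ : ∀ e, c e ≠ 0 → ∃ g : G, ∃ e₀ ∈ E₀, e = ρ g • e₀ := by
    intro e he
    by_contra! h
    have key : ∀ x g : G, δ.toFun (ρ (g * x)) e = δ.toFun (ρ g) e := by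
      intro x
      have hx : x ∈ Subgroup.closure (S : Set G) := hS ▸ Subgroup.mem_top x
      induction hx using Subgroup.closure_induction with
      | mem s hs =>
        intro g
        rw [hmul, add_eq_left]
        by_contra hne
        refine h g ((ρ g)⁻¹ • e) ?_ (smul_inv_smul _ _).symm
        exact Finset.mem_biUnion.2 ⟨s, hs, Finsupp.mem_support_iff.2 hne⟩
      | one => intro g; rw [mul_one]
      | mul a b _ _ ha hb => intro g; rw [← mul_assoc, hb, ha]
      | inv a _ ha => intro g; rw [← ha, inv_mul_cancel_right]
    obtain ⟨x, hx⟩ := (hc e).infinite_compl.nonempty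
    simp only [Set.mem_compl_iff, Set.mem_ofPred_eq, not_not] at hx
    have := key x 1
    rw [one_mul, hx, _root_.map_one, map_one] at this
    exact he this
  -- Exceptional sets have constant size along orbits, so one `F` larger than all those over `E₀`
  -- escapes each relevant one: `c` is nonzero only on the supports of the δ(x) with x in `F`.
  obtain ⟨F, hF⟩ := Infinite.exists_subset_card_eq G (E₀.sup (fun e => (A e).ncard) + 1)
  have hsupp : (Function.support c).Finite := by
    refine (Finset.finite_toSet (F.biUnion fun x => (δ.toFun (ρ x)).support)).subset ?_
    intro e he
    obtain ⟨g, e₀, he₀, rfl⟩ := hE₀ e he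
    have hcard : (A (ρ g • e₀)).ncard < F.card := by
      rw [hA, hF]
      exact Nat.lt_succ_of_le (Finset.le_sup (f := fun e => (A e).ncard) he₀)
    obtain ⟨x, hxF, hxA⟩ : ∃ x ∈ F, x ∉ A (ρ g • e₀) := by
      by_contra! h
      have := Set.ncard_le_ncard (s := (F : Set G)) h (hc _)
      rw [Set.ncard_coe_finset] at this
      exact absurd this (not_le.2 hcard)
    simp only [A, Set.mem_ofPred_eq, not_not] at hxA
    simp only [Finset.coe_biUnion, Set.mem_iUnion]
    exact ⟨x, hxF, Finsupp.mem_support_iff.2 (hxA ▸ he)⟩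
  obtain ⟨x, hx⟩ := δ.exists_forall_conj_mem_of_coboundary ρ.range one_ne_zero
    (Finsupp.ofSupportFinite c hsupp) (by
      rintro _ ⟨g, rfl⟩
      ext e
      rw [one_smul, Finsupp.sub_apply, smul_apply, eq_sub_iff_add_eq]
      exact (hcg g e).symm)
  exact ⟨x, fun g => hx _ ⟨g, rfl⟩⟩

theorem exists_forall_conj_mem [Finite L] {G : Type*} [Group G] (hG : IsOEGroup G)
    (ρ : G →* Γ) (hρ : Function.Injective ρ) : ∃ x : Γ, ∀ g, x⁻¹ * ρ g * x ∈ K := by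
  rcases finite_or_infinite G with h | h
  · exact δ.exists_forall_conj_mem_of_finite ρ
  · obtain ⟨S, hS, hE⟩ := hG.ends_lt_two
    exact δ.exists_forall_conj_mem_of_infinite hS hE ρ hρ

omit δ in
theorem conj_mem_of_forall_conj_mem {L : Subgroup Γ} [Finite L] {x : Γ}
    (h : ∀ l ∈ L, x * l * x⁻¹ ∈ L) : ∀ l ∈ L, x⁻¹ * l * x ∈ L := by
  intro l hl
  let φ : L → L := fun l => ⟨x * l * x⁻¹, h l l.2⟩
  have hφ : Function.Injective φ := fun a b hab => by
    have := congrArg Subtype.val hab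
    exact Subtype.ext (by simpa [φ] using this)
  obtain ⟨a, ha⟩ := (Finite.injective_iff_surjective.1 hφ) ⟨l, hl⟩
  have := congrArg Subtype.val ha
  simp only [φ] at this
  rw [← this]
  simp [mul_assoc]

/-- If `K` is infinite, the base vertex is the only vertex fixed by `K`. -/
theorem mem_of_le_conj [Finite L] [Infinite K] {x : Γ} (h : ∀ k ∈ K, x⁻¹ * k * x ∈ K) : x ∈ K := by
  by_contra hx
  have hne : ((1 : Γ) : Γ ⧸ K) ≠ x := by
    rw [ne_eq, QuotientGroup.eq]; simpa using hx
  obtain ⟨m, hm, -, hfix⟩ := δ.isTree.exists_adj_dist_eq δ.adj_smul hne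
  -- Fixing a second vertex, K would fix an edge and embed in the finite group L.
  obtain ⟨g, -, hg⟩ := δ.mem_of_adj_of_smul_eq hm
  have hKL : ∀ k ∈ K, g⁻¹ * k * g ∈ L := by
    intro k hk
    have h1 : k • ((1 : Γ) : Γ ⧸ K) = ((1 : Γ) : Γ ⧸ K) := by
      rw [MulAction.Quotient.smul_coe, smul_eq_mul, eq_comm, QuotientGroup.eq]; simpa using hk
    have h2 : k • (x : Γ ⧸ K) = (x : Γ ⧸ K) := by
      rw [MulAction.Quotient.smul_coe, smul_eq_mul, eq_comm, QuotientGroup.eq]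
      simpa [mul_assoc] using h k hk
    exact hg k h1 (hfix k h1 h2)
  have : Function.Injective fun k : K => (⟨g⁻¹ * k * g, hKL k k.2⟩ : L) := by
    intro a b hab
    have := congrArg Subtype.val hab
    exact Subtype.ext (by simpa using this)
  exact not_finite_iff_infinite.2 ‹Infinite K› (Finite.of_injective _ this)

/-- A subgroup of the base group that fixes a second vertex is conjugate in the base group into
the edge group. -/
theorem exists_mem_conj_mem {M : Subgroup Γ} (hM : M ≤ K) {s : Γ} (hs : s ∉ K)
    (hMs : ∀ l ∈ M, s⁻¹ * l * s ∈ K) : ∃ k ∈ K, ∀ l ∈ M, k⁻¹ * l * k ∈ L := by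
  have hne : ((1 : Γ) : Γ ⧸ K) ≠ s := by
    rw [ne_eq, QuotientGroup.eq]; simpa using hs
  obtain ⟨m, hm, -, hfix⟩ := δ.isTree.exists_adj_dist_eq δ.adj_smul hne
  obtain ⟨g, hgm, hg⟩ := δ.mem_of_adj_of_smul_eq hm
  have hgK : g ∈ K := by
    have : ((1 : Γ) : Γ ⧸ K) = g := by rcases hgm with h | h <;> exact h.1
    rw [QuotientGroup.eq] at this
    simpa using this
  refine ⟨g, hgK, fun l hl => ?_⟩
  have h1 : l • ((1 : Γ) : Γ ⧸ K) = ((1 : Γ) : Γ ⧸ K) := by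
    rw [MulAction.Quotient.smul_coe, smul_eq_mul, eq_comm, QuotientGroup.eq]; simpa using hM hl
  have h2 : l • (s : Γ ⧸ K) = (s : Γ ⧸ K) := by
    rw [MulAction.Quotient.smul_coe, smul_eq_mul, eq_comm, QuotientGroup.eq]
    simpa [mul_assoc] using hMs l hl
  exact hg l h1 (hfix l h1 h2)

/-- The normalizer of the edge group `L` is generated by its elements in the base group and the
stable letter. -/
theorem induction_on_normalizing [Finite L] {motive : Γ → Prop}
    (base : ∀ k ∈ K, (∀ l ∈ L, k * l * k⁻¹ ∈ L) → motive k)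
    (mul : ∀ k ∈ K, (∀ l ∈ L, k * l * k⁻¹ ∈ L) → ∀ s, (∀ l ∈ L, s * l * s⁻¹ ∈ L) → motive s →
      motive (k * t * s) ∧ motive (k * t⁻¹ * s)) (s : Γ)
    (hs : ∀ l ∈ L, s * l * s⁻¹ ∈ L) : motive s := by
  obtain ⟨n, hn⟩ : ∃ n, δ.tree.dist ((1 : Γ) : Γ ⧸ K) (s : Γ ⧸ K) = n := ⟨_, rfl⟩
  induction n using Nat.strong_induction_on generalizing s with | _ n ih
  by_cases hsK : s ∈ K
  · exact base s hsK hs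
  have hne : ((1 : Γ) : Γ ⧸ K) ≠ s := by
    rw [ne_eq, QuotientGroup.eq]; simpa using hsK
  have hs' := conj_mem_of_forall_conj_mem hs
  obtain ⟨m, hm, hd, hfix⟩ := δ.isTree.exists_adj_dist_eq δ.adj_smul hne
  obtain ⟨g, hgm, hg⟩ := δ.mem_of_adj_of_smul_eq hm
  have hgK : g ∈ K := by
    have : ((1 : Γ) : Γ ⧸ K) = g := by rcases hgm with h | h <;> exact h.1
    rw [QuotientGroup.eq] at this
    simpa using this
  have hgL : ∀ l ∈ L, g⁻¹ * l * g ∈ L := by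
    intro l hl
    have h1 : l • ((1 : Γ) : Γ ⧸ K) = ((1 : Γ) : Γ ⧸ K) := by
      rw [MulAction.Quotient.smul_coe, smul_eq_mul, eq_comm, QuotientGroup.eq]
      simpa using δ.le hl
    have h2 : l • (s : Γ ⧸ K) = (s : Γ ⧸ K) := by
      rw [MulAction.Quotient.smul_coe, smul_eq_mul, eq_comm, QuotientGroup.eq]
      simpa [mul_assoc] using δ.le (hs' l hl)
    exact hg l h1 (hfix l h1 h2)
  have hgL' : ∀ l ∈ L, g * l * g⁻¹ ∈ L := by
    simpa using conj_mem_of_forall_conj_mem (x := g⁻¹) (by simpa using hgL)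
  -- L fixes the geodesic's first vertex m, so g normalizes L; translating m back to the base vertex
  -- shortens the distance.
  have step : ∀ y : Γ, (∀ l ∈ L, y⁻¹ * l * y ∈ L) → m = (y : Γ ⧸ K) →
      motive (y⁻¹ * s) ∧ ∀ l ∈ L, (y⁻¹ * s) * l * (y⁻¹ * s)⁻¹ ∈ L := by
    intro y hy hmy
    have hL : ∀ l ∈ L, (y⁻¹ * s) * l * (y⁻¹ * s)⁻¹ ∈ L := fun l hl => by
      have := hy _ (hs l hl)
      simpa [mul_assoc] using this
    refine ⟨ih _ ?_ (y⁻¹ * s) hL rfl, hL⟩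
    have : δ.tree.dist ((1 : Γ) : Γ ⧸ K) ((y⁻¹ * s : Γ) : Γ ⧸ K) = δ.tree.dist m s := by
      rw [← dist_smul_smul δ.connected δ.adj_smul y, hmy, MulAction.Quotient.smul_coe,
        MulAction.Quotient.smul_coe, smul_eq_mul, smul_eq_mul, mul_one, mul_inv_cancel_left]
    omega
  rcases hgm with ⟨-, hmg⟩ | ⟨-, hmg⟩
  · obtain ⟨h1, h2⟩ := step (g * t) (fun l hl => by
      have := δ.conj_mem' _ (hgL l hl)
      simpa [mul_assoc] using this) hmg
    have := (mul g hgK hgL' _ h2 h1).1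
    rwa [mul_inv_cancel_left] at this
  · obtain ⟨h1, h2⟩ := step (g * t⁻¹) (fun l hl => by
      have := δ.conj_mem _ (hgL l hl)
      simpa [mul_assoc] using this) hmg
    have := (mul g hgK hgL' _ h2 h1).2
    rwa [mul_inv_cancel_left] at this

end SplittingCocycle

/-! ### The cocycle of an HNN-extension -/

namespace HNNExtension

variable {G : Type*} [Group G] {H : Subgroup G} (f : MulAut H)

theorem closure_eq_top : Subgroup.closure
    (insert t ((of : G →* HNNExtension G H H f).range : Set (HNNExtension G H H f))) = ⊤ := by
  rw [eq_top_iff]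
  intro x _
  induction x using HNNExtension.induction_on with
  | of g => exact Subgroup.subset_closure (Or.inr ⟨g, rfl⟩)
  | t => exact Subgroup.subset_closure (Or.inl rfl)
  | mul x y hx hy => exact mul_mem (hx trivial) (hy trivial)
  | inv x hx => exact inv_mem (hx trivial)

/-- The affine action of the HNN-extension whose translation part counts the edges of the
Bass–Serre tree. -/
noncomputable def affineAction : HNNExtension G H H f →* Equiv.Perm
    ((HNNExtension G H H f ⧸ H.map (of : G →* HNNExtension G H H f)) →₀ ℤ) :=
  lift ((MulAction.toPermHom (HNNExtension G H H f) _).comp of)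
    (Equiv.addRight (Finsupp.single ((1 : HNNExtension G H H f) : _ ⧸ H.map of) 1) *
      MulAction.toPermHom (HNNExtension G H H f) _ t) (by
    intro a
    ext1 m
    -- The defining relation is respected because H fixes the translation vector.
    have h1 : (of (f a : G) : HNNExtension G H H f) •
        (((1 : HNNExtension G H H f) : HNNExtension G H H f ⧸ H.map (of : G →* _))) =
        ((1 : HNNExtension G H H f) : HNNExtension G H H f ⧸ H.map (of : G →* _)) := by
      rw [MulAction.Quotient.smul_coe, smul_eq_mul, mul_one, eq_comm, QuotientGroup.eq]
      simpa using Subgroup.mem_map_of_mem of (f a).2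
    simp only [Equiv.Perm.mul_apply, MonoidHom.comp_apply, MulAction.toPermHom_apply,
      MulAction.toPerm_apply, Equiv.coe_addRight, smul_add, smul_smul, t_mul_of,
      Finsupp.comapSMul_single, h1])

theorem affineAction_of (g : G) (m) : affineAction f (of g) m = (of g : HNNExtension G H H f) • m := by
  rw [affineAction, lift_of]; rfl

theorem affineAction_t (m) : affineAction f t m = (t : HNNExtension G H H f) • m +
    Finsupp.single ((1 : HNNExtension G H H f) : _ ⧸ H.map of) 1 := by
  rw [affineAction, lift_t]; rfl

/-- The linear part is the permutation action, so the translation part is a crossed homomorphism. -/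
theorem affineAction_apply (x : HNNExtension G H H f) :
    ∀ m, affineAction f x m = x • m + affineAction f x 0 := by
  induction x using HNNExtension.induction_on with
  | of g => intro m; simp [affineAction_of]
  | t => intro m; simp [affineAction_t]
  | mul x y hx hy =>
    intro m
    rw [map_mul, Equiv.Perm.mul_apply, Equiv.Perm.mul_apply, hy, hx, smul_add, hx (affineAction f y 0),
      mul_smul, add_assoc]
  | inv x hx =>
    have key : ∀ m, affineAction f x⁻¹ m = x⁻¹ • m - x⁻¹ • affineAction f x 0 := by
      intro m
      have h := hx (affineAction f x⁻¹ m)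
      rw [← Equiv.Perm.mul_apply, ← map_mul, mul_inv_cancel, map_one, Equiv.Perm.one_apply] at h
      rw [eq_sub_iff_add_eq]
      apply smul_left_cancel x
      rw [smul_add, smul_inv_smul, smul_inv_smul, ← h]
    intro m
    rw [key, key 0, smul_zero, zero_sub, sub_eq_add_neg]

/-- The cocycle of an HNN-extension both of whose associated subgroups are `H`. -/
noncomputable def splittingCocycle : SplittingCocycle (of : G →* HNNExtension G H H f).range
    (H.map (of : G →* HNNExtension G H H f)) t where
  toFun x := affineAction f x 0
  map_mul x y := by
    rw [map_mul, Equiv.Perm.mul_apply, affineAction_apply, add_comm]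
  map_of_mem := by
    rintro _ ⟨g, rfl⟩
    rw [affineAction_of, smul_zero]
  map_t := by rw [affineAction_t, smul_zero, zero_add]
  le := by
    rintro _ ⟨g, -, rfl⟩
    exact ⟨g, rfl⟩
  conj_mem := by
    rintro _ ⟨g, hg, rfl⟩
    have := equiv_eq_conj (φ := (f : H ≃* H)) ⟨g, hg⟩
    rw [← this]
    exact Subgroup.mem_map_of_mem of (f ⟨g, hg⟩).2
  conj_mem' := by
    rintro _ ⟨g, hg, rfl⟩
    have := equiv_symm_eq_conj (φ := (f : H ≃* H)) ⟨g, hg⟩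
    rw [← this]
    exact Subgroup.mem_map_of_mem of (f.symm ⟨g, hg⟩).2
  closure_eq_top := closure_eq_top f

end HNNExtension

/-! ### Orbits of inversion -/

section Counting

theorem orderOf_le_two_iff {Q : Type*} [Group Q] [Finite Q] (q : Q) :
    orderOf q ≤ 2 ↔ q⁻¹ = q := by
  rw [inv_eq_iff_mul_eq_one, ← pow_two, ← orderOf_dvd_iff_pow_eq_one]
  refine ⟨fun h => ?_, Nat.le_of_dvd two_pos⟩
  have := orderOf_pos q
  interval_cases orderOf q <;> norm_num

/-- The number of orbits of the inversion map on a finite group. -/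
theorem card_quotient_eq_of_iff_eq_or_eq_inv {X Q : Type*} [Group Q] [Finite Q] (s : Setoid X)
    (π : X → Q) (hπ : Function.Surjective π)
    (hs : ∀ x y, s x y ↔ π x = π y ∨ π x = (π y)⁻¹) :
    (Nat.card (Quotient s) : ℚ) =
      ((Nat.card Q : ℚ) + (Nat.card {q : Q // orderOf q ≤ 2} : ℚ)) / 2 := by
  classical
  obtain ⟨σ, hσ⟩ := hπ.hasRightInverse
  let c : Q → Quotient s := fun q => Quotient.mk s (σ q)
  have hc : ∀ p q, c p = c q ↔ p = q ∨ p = q⁻¹ := by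
    intro p q
    rw [Quotient.eq, hs, hσ, hσ]
  have hsurj : Function.Surjective c := by
    intro z
    induction z using Quotient.inductionOn with | _ x
    exact ⟨π x, Quotient.sound ((hs _ _).2 (Or.inl (hσ _)))⟩
  have := Fintype.ofFinite Q
  have : Finite (Quotient s) := Finite.of_surjective c hsurj
  have := Fintype.ofFinite (Quotient s)
  have h1 : Fintype.card Q = ∑ z : Quotient s, (Finset.univ.filter fun q => c q = z).card :=
    Finset.card_eq_sum_card_fiberwise fun q _ => Finset.mem_univ _
  have h2 : (Finset.univ.filter fun q : Q => orderOf q ≤ 2).card = ∑ z : Quotient s,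
      ((Finset.univ.filter fun q : Q => orderOf q ≤ 2).filter fun q => c q = z).card :=
    Finset.card_eq_sum_card_fiberwise fun q _ => Finset.mem_univ _
  -- A fibre {q, q⁻¹} contributes 1 + 1 if q is its own inverse and 2 + 0 otherwise.
  have h3 : ∀ z : Quotient s, (Finset.univ.filter fun q => c q = z).card +
      ((Finset.univ.filter fun q : Q => orderOf q ≤ 2).filter fun q => c q = z).card = 2 := by
    intro z
    obtain ⟨q, rfl⟩ := hsurj z
    have e1 : (Finset.univ.filter fun p => c p = c q) = {q, q⁻¹} := by
      ext p; simp [hc]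
    by_cases hq : q⁻¹ = q
    · have e2 : ((Finset.univ.filter fun p : Q => orderOf p ≤ 2).filter fun p => c p = c q)
          = {q} := by
        ext p
        simp only [Finset.mem_filter, Finset.mem_univ, true_and, hc, hq, or_self,
          orderOf_le_two_iff, Finset.mem_singleton]
        exact ⟨And.right, fun h => ⟨h ▸ hq, h⟩⟩
      rw [e1, e2, hq]
      simp
    · have e2 : ((Finset.univ.filter fun p : Q => orderOf p ≤ 2).filter fun p => c p = c q)
          = ∅ := by
        ext p
        simp only [Finset.mem_filter, Finset.mem_univ, true_and, hc, orderOf_le_two_iff,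
          Finset.notMem_empty, iff_false, not_and, not_or]
        refine fun hp => ⟨fun h => hq (h ▸ hp), fun h => hq ?_⟩
        rw [h, inv_inv] at hp
        exact hp.symm
      rw [e1, e2, Finset.card_pair (Ne.symm hq)]
      simp
  have h4 : Fintype.card Q + (Finset.univ.filter fun q : Q => orderOf q ≤ 2).card =
      2 * Fintype.card (Quotient s) := by
    rw [h1, h2, ← Finset.sum_add_distrib, Finset.sum_congr rfl fun z _ => h3 z]
    simp [mul_comm]
  rw [Nat.card_eq_fintype_card, Nat.card_eq_fintype_card, Nat.card_eq_fintype_card,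
    Fintype.card_subtype, eq_div_iff two_ne_zero, mul_comm]
  exact_mod_cast h4.symm

end Counting

/-! ### The quotient of Out(H) by the image of the normalizer -/

section

variable {G : Type*} [Group G] (H : Subgroup G)

theorem Inn_le_range_normalizerMonoidHom : Inn H ≤ H.normalizerMonoidHom.range := by
  rintro _ ⟨h, rfl⟩
  exact ⟨⟨h, Subgroup.le_normalizer h.2⟩, by ext x; rfl⟩

theorem range_normalizerMonoidHom_le_autBar : H.normalizerMonoidHom.range ≤ autBar H := by
  rintro _ ⟨n, rfl⟩
  refine ⟨MulAut.conj (n : G), ?_, fun h => rfl⟩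
  change H.map (MulAut.conj (n : G)).toMonoidHom = H
  ext x
  constructor
  · rintro ⟨y, hy, rfl⟩
    exact (Subgroup.mem_normalizer_iff.1 n.2 y).1 hy
  · intro hx
    refine ⟨(n : G)⁻¹ * x * n, (Subgroup.mem_normalizer_iff.1 n.2 _).2 ?_, ?_⟩
    · simpa [mul_assoc] using hx
    · simp [mul_assoc]

theorem normalizerTilde_le_autTilde : normalizerTilde H ≤ autTilde H :=
  Subgroup.map_mono (range_normalizerMonoidHom_le_autBar H)

theorem normalizerTilde_normal (h : autTilde H ≤ Subgroup.center (Out H)) :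
    (normalizerTilde H).Normal where
  conj_mem n hn g := by
    have := Subgroup.mem_center_iff.1 (h (normalizerTilde_le_autTilde H hn)) g
    rwa [this, mul_inv_cancel_right]

variable [(normalizerTilde H).Normal]

/-- The projection of `Aut(H)` onto the quotient of `Out(H)` by the image of the normalizer. -/
def outProj : MulAut H →* Out H ⧸ normalizerTilde H :=
  (QuotientGroup.mk' (normalizerTilde H)).comp (QuotientGroup.mk' (Inn H))

theorem outProj_surjective : Function.Surjective (outProj H) :=
  (QuotientGroup.mk'_surjective _).comp (QuotientGroup.mk'_surjective _)

theorem outProj_eq_one_iff (f : MulAut H) :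
    outProj H f = 1 ↔ f ∈ H.normalizerMonoidHom.range := by
  rw [outProj, MonoidHom.comp_apply, QuotientGroup.mk'_apply, QuotientGroup.eq_one_iff]
  constructor
  · rintro ⟨y, hy, hyf⟩
    rw [QuotientGroup.mk'_apply, QuotientGroup.mk'_apply, QuotientGroup.eq] at hyf
    have := mul_mem hy (Inn_le_range_normalizerMonoidHom H hyf)
    rwa [mul_inv_cancel_left] at this
  · exact fun hf => ⟨f, hf, rfl⟩

/-- The class of β is central in Out(H), so the conjugation already disappears there. -/
theorem outProj_conj (h : autTilde H ≤ Subgroup.center (Out H)) {β : MulAut H}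
    (hβ : β ∈ autBar H) (f : MulAut H) : outProj H (β * f * β⁻¹) = outProj H f := by
  have h1 : (QuotientGroup.mk' (Inn H) β) ∈ Subgroup.center (Out H) := h ⟨β, hβ, rfl⟩
  have h2 := Subgroup.mem_center_iff.1 h1 (QuotientGroup.mk' (Inn H) f)
  rw [outProj, MonoidHom.comp_apply, MonoidHom.comp_apply,
    (QuotientGroup.mk' (Inn H)).map_mul, (QuotientGroup.mk' (Inn H)).map_mul,
    (QuotientGroup.mk' (Inn H)).map_inv, ← h2, mul_inv_cancel_right]

end

/-! ### Isomorphisms from changing the stable letter -/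

namespace HNNExtension

variable {G : Type*} [Group G] {H : Subgroup G}

/-- Multiplying the stable letter by an element of the normalizer. -/
def mulNormalizer (f f' : MulAut H) (n : Subgroup.normalizer (H : Set G))
    (h : f' = f * H.normalizerMonoidHom n) : HNNExtension G H H f' →* HNNExtension G H H f :=
  lift of (t * of (n : G)) fun a => by
    have h1 : t * of ((H.normalizerMonoidHom n a : H) : G) =
      (of (f (H.normalizerMonoidHom n a) : G) * t : HNNExtension G H H f) := t_mul_of _
    have h2 : (n : G) * a = (H.normalizerMonoidHom n a : G) * n := by
      change (n : G) * a = (n * a * (n : G)⁻¹) * n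
      simp
    rw [h, MulAut.mul_apply, ← mul_assoc, ← h1, mul_assoc, mul_assoc, ← map_mul, ← map_mul, h2]

theorem mulNormalizer_comp (f f' : MulAut H) (n n' : Subgroup.normalizer (H : Set G))
    (h : f' = f * H.normalizerMonoidHom n) (h' : f = f' * H.normalizerMonoidHom n')
    (hn : (n' : G) = (n : G)⁻¹) :
    (mulNormalizer f f' n h).comp (mulNormalizer f' f n' h') = MonoidHom.id _ := by
  ext
  · simp [mulNormalizer]
  · simp [mulNormalizer, hn]

/-- Replacing the stable letter by its inverse. -/
def invStable (f f' : MulAut H) (h : f' = f⁻¹) :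
    HNNExtension G H H f' →* HNNExtension G H H f :=
  lift of t⁻¹ fun a => by
    rw [h]; exact inv_t_mul_of (φ := (f : H ≃* H)) a

theorem invStable_comp (f f' : MulAut H) (h : f' = f⁻¹) (h' : f = f'⁻¹) :
    (invStable f f' h).comp (invStable f' f h') = MonoidHom.id _ := by
  ext
  · simp [invStable]
  · simp [invStable]

theorem nonempty_mulEquiv_mul_normalizer (f : MulAut H) (n : Subgroup.normalizer (H : Set G)) :
    Nonempty (HNNExtension G H H f ≃* HNNExtension G H H (f * H.normalizerMonoidHom n)) := by
  have h' : f = f * H.normalizerMonoidHom n * H.normalizerMonoidHom n⁻¹ := by simp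
  exact ⟨MonoidHom.toMulEquiv (mulNormalizer _ _ n⁻¹ h') (mulNormalizer _ _ n rfl)
    (mulNormalizer_comp _ _ _ _ _ _ rfl) (mulNormalizer_comp _ _ _ _ _ _ (inv_inv _).symm)⟩

theorem nonempty_mulEquiv_inv (f : MulAut H) :
    Nonempty (HNNExtension G H H f ≃* HNNExtension G H H f⁻¹) :=
  ⟨MonoidHom.toMulEquiv (invStable _ _ (inv_inv f).symm) (invStable _ _ rfl)
    (invStable_comp _ _ _ _) (invStable_comp _ _ _ _)⟩

variable [(normalizerTilde H).Normal]

theorem nonempty_mulEquiv_of_outProj_eq {f f' : MulAut H} (h : outProj H f = outProj H f') :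
    Nonempty (HNNExtension G H H f ≃* HNNExtension G H H f') := by
  have h1 : outProj H (f⁻¹ * f') = 1 := by rw [map_mul, map_inv, h, inv_mul_cancel]
  obtain ⟨n, hn⟩ := (outProj_eq_one_iff H _).1 h1
  have h2 : f' = f * H.normalizerMonoidHom n := by rw [hn, mul_inv_cancel_left]
  rw [h2]
  exact nonempty_mulEquiv_mul_normalizer f n

theorem nonempty_mulEquiv_of_outProj {f f' : MulAut H}
    (h : outProj H f = outProj H f' ∨ outProj H f = (outProj H f')⁻¹) :
    Nonempty (HNNExtension G H H f ≃* HNNExtension G H H f') := by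
  rcases h with h | h
  · exact nonempty_mulEquiv_of_outProj_eq h
  · rw [← map_inv] at h
    obtain ⟨e⟩ := nonempty_mulEquiv_of_outProj_eq h
    obtain ⟨e'⟩ := nonempty_mulEquiv_inv f'
    exact ⟨e.trans e'.symm⟩

end HNNExtension

/-! ### Invariants of an arbitrary isomorphism -/

namespace HNNExtension

variable {G : Type*} [Group G] {H : Subgroup G} {f f' : MulAut H}

/-- The image of G fixes a vertex, so a conjugation moves it into the base group. Equality follows
by counting if G is finite; otherwise the same argument for the inverse conjugates the base group
into the image, and an infinite base group fixes only one vertex. -/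
theorem exists_mulEquiv_of_eq (hG : IsOEGroup G) [Finite H]
    (e : HNNExtension G H H f ≃* HNNExtension G H H f') :
    ∃ (e : HNNExtension G H H f ≃* HNNExtension G H H f') (a : MulAut G),
      ∀ g, e (of g) = of (a g) := by
  have : Finite (H.map (of : G →* HNNExtension G H H f)) := Finite.Set.finite_image _ _
  have : Finite (H.map (of : G →* HNNExtension G H H f')) := Finite.Set.finite_image _ _
  obtain ⟨x, hx⟩ := (splittingCocycle f').exists_forall_conj_mem hG
    (e.toMonoidHom.comp of) (e.injective.comp (of_injective _))
  let e₁ : HNNExtension G H H f ≃* HNNExtension G H H f' := e.trans (MulAut.conj x⁻¹)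
  have he₁ : ∀ g, e₁ (of g) ∈ (of : G →* HNNExtension G H H f').range := by
    intro g
    simpa [e₁] using hx g
  choose a ha using he₁
  have hainj : Function.Injective a := by
    intro g g' h
    apply of_injective f
    apply e₁.injective
    rw [← ha, ← ha, h]
  have hamul : ∀ g g', a (g * g') = a g * a g' := by
    intro g g'
    apply of_injective f'
    rw [map_mul, ha, ha, ha, map_mul, map_mul]
  have hasurj : Function.Surjective a := by
    rcases finite_or_infinite G with hfin | hinf
    · exact Finite.injective_iff_surjective.1 hainj
    have : Infinite (of : G →* HNNExtension G H H f').range :=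
      Infinite.of_injective _ (MonoidHom.ofInjective (of_injective f')).injective
    obtain ⟨y, hy⟩ := (splittingCocycle f).exists_forall_conj_mem hG
      (e₁.symm.toMonoidHom.comp of) (e₁.symm.injective.comp (of_injective _))
    have key : ∀ g', ∃ g, (e₁ y)⁻¹ * of g' * e₁ y = of (a g) := by
      intro g'
      obtain ⟨g, hg⟩ := hy g'
      refine ⟨g, ?_⟩
      rw [ha, hg]
      simp
    have hz : e₁ y ∈ (of : G →* HNNExtension G H H f').range := by
      refine (splittingCocycle f').mem_of_le_conj ?_
      rintro _ ⟨g', rfl⟩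
      obtain ⟨g, hg⟩ := key g'
      exact ⟨a g, hg.symm⟩
    obtain ⟨z, hz⟩ := hz
    intro g'
    obtain ⟨g, hg⟩ := key (z * g' * z⁻¹)
    refine ⟨g, of_injective f' ?_⟩
    rw [← hg, ← hz]
    simp [mul_assoc]
  exact ⟨e₁, MulEquiv.ofBijective (MonoidHom.mk' a hamul) ⟨hainj, hasurj⟩, fun g => (ha g).symm⟩

/-- The exponent sum after e kills G, hence is a multiple of the exponent sum on the source;
surjectivity makes the factor a unit of ℤ. -/
theorem height_apply_t (e : HNNExtension G H H f ≃* HNNExtension G H H f') (a : MulAut G)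
    (ha : ∀ g, e (of g) = of (a g)) :
    (splittingCocycle f').height (e t) = Multiplicative.ofAdd 1 ∨
      (splittingCocycle f').height (e t) = Multiplicative.ofAdd (-1) := by
  set η := (splittingCocycle f').height.comp e.toMonoidHom
  have h1 : η = (zpowersHom _ (η t)).comp (splittingCocycle f).height := by
    refine hom_ext (MonoidHom.ext fun g => ?_) ?_
    · have h1 : η (of g) = 1 := by
        change (splittingCocycle f').height (e (of g)) = 1
        rw [ha]
        exact (splittingCocycle f').height_of_mem ⟨_, rfl⟩
      rw [MonoidHom.comp_apply, h1, MonoidHom.comp_apply, MonoidHom.comp_apply,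
        (splittingCocycle f).height_of_mem ⟨_, rfl⟩, _root_.map_one]
    · conv_rhs => rw [MonoidHom.comp_apply, (splittingCocycle f).height_t, zpowersHom_apply,
        toAdd_ofAdd, zpow_one]
  have h2 : η (e.symm t) = Multiplicative.ofAdd 1 := by
    change (splittingCocycle f').height (e (e.symm t)) = _
    rw [e.apply_symm_apply, SplittingCocycle.height_t]
  rw [h1, MonoidHom.comp_apply, zpowersHom_apply] at h2
  have h3 := congrArg Multiplicative.toAdd h2
  rw [toAdd_zpow, toAdd_ofAdd, smul_eq_mul] at h3
  rcases Int.isUnit_iff.1 (IsUnit.of_mul_eq_one_right _ h3) with h | h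
  · exact Or.inl h
  · exact Or.inr h

/-- As t normalizes H, the image of H fixes both the base vertex and its translate by e(t), distinct
since e(t) has exponent sum ±1. So it is conjugate in G into H, and onto H by cardinality. -/
theorem exists_mulEquiv_autStabilizer (hG : IsOEGroup G) [Finite H]
    (e : HNNExtension G H H f ≃* HNNExtension G H H f') :
    ∃ (e : HNNExtension G H H f ≃* HNNExtension G H H f') (a : MulAut G),
      a ∈ autStabilizer H ∧ ∀ g, e (of g) = of (a g) := by
  obtain ⟨e, a, ha⟩ := exists_mulEquiv_of_eq hG e
  have ht : e t ∉ (of : G →* HNNExtension G H H f').range := by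
    intro h
    have := (splittingCocycle f').height_of_mem h
    rcases height_apply_t e a ha with h' | h' <;> rw [this] at h' <;>
    · have := congrArg Multiplicative.toAdd h'
      simp at this
  have hM : (H.map a.toMonoidHom).map (of : G →* HNNExtension G H H f') ≤
      (of : G →* HNNExtension G H H f').range := by
    rintro _ ⟨g, -, rfl⟩
    exact ⟨g, rfl⟩
  obtain ⟨_, ⟨k, rfl⟩, hk⟩ := (splittingCocycle f').exists_mem_conj_mem hM ht (by
    rintro _ ⟨_, ⟨h, hh, rfl⟩, rfl⟩
    refine ⟨a (f.symm ⟨h, hh⟩), ?_⟩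
    change _ = (e t)⁻¹ * of (a h) * e t
    rw [← ha, ← ha, equiv_symm_eq_conj (φ := (f : H ≃* H)) ⟨h, hh⟩]
    simp)
  have hkH : ∀ h ∈ H, k⁻¹ * a h * k ∈ H := by
    intro h hh
    obtain ⟨h', hh', he⟩ := hk (of (a h)) ⟨_, ⟨h, hh, rfl⟩, rfl⟩
    rw [← map_inv, ← map_mul, ← map_mul] at he
    rwa [← of_injective f' he]
  refine ⟨e.trans (MulAut.conj (of k)⁻¹), MulAut.conj k⁻¹ * a, ?_, fun g => ?_⟩
  · have hle : H.map (MulAut.conj k⁻¹ * a).toMonoidHom ≤ H := by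
      rintro _ ⟨h, hh, rfl⟩
      have := hkH h hh
      change k⁻¹ * a h * (k⁻¹)⁻¹ ∈ H
      rwa [inv_inv]
    have : Set.Finite (H : Set G) := Set.toFinite _
    exact SetLike.coe_injective (Set.eq_of_subset_of_ncard_le hle (by
      rw [Subgroup.coe_map]
      exact (Set.ncard_image_of_injective _ (MulAut.conj k⁻¹ * a).injective).ge) this)
  · simp [ha]

variable [(normalizerTilde H).Normal]

/-- The action by conjugation on `H` of an element of its normalizer in the HNN-extension is
determined modulo the normalizer in the base group by the exponent sum of the stable letter. -/
theorem exists_conj_eq [Finite H] (s : HNNExtension G H H f)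
    (hs : ∀ l ∈ H.map (of : G →* HNNExtension G H H f), s * l * s⁻¹ ∈
      H.map (of : G →* HNNExtension G H H f)) :
    ∃ θ : MulAut H, (∀ h : H, s * of (h : G) * s⁻¹ = of (θ h : G)) ∧
      outProj H θ = outProj H f ^ (Multiplicative.toAdd ((splittingCocycle f).height s)) := by
  have : Finite (H.map (of : G →* HNNExtension G H H f)) := Finite.Set.finite_image _ _
  have base : ∀ k : G, (∀ l ∈ H.map (of : G →* HNNExtension G H H f), of k * l * (of k)⁻¹ ∈
      H.map (of : G →* HNNExtension G H H f)) →
      ∃ θ : MulAut H, (∀ h : H, (of k : HNNExtension G H H f) * of (h : G) * (of k)⁻¹ =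
        of (θ h : G)) ∧ outProj H θ = 1 := by
    intro k hk
    have hk1 : ∀ h ∈ H, k * h * k⁻¹ ∈ H := by
      intro h hh
      obtain ⟨h', hh', he⟩ := hk (of h) ⟨h, hh, rfl⟩
      rw [← map_inv, ← map_mul, ← map_mul] at he
      rwa [← of_injective f he]
    have hk2 := SplittingCocycle.conj_mem_of_forall_conj_mem hk1
    have hkn : k ∈ Subgroup.normalizer (H : Set G) := by
      rw [Subgroup.mem_normalizer_iff]
      refine fun h => ⟨hk1 h, fun hh => ?_⟩
      have := hk2 _ hh
      simpa [mul_assoc] using this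
    refine ⟨H.normalizerMonoidHom ⟨k, hkn⟩, fun h => ?_, (outProj_eq_one_iff H _).2 ⟨_, rfl⟩⟩
    rw [← map_inv, ← map_mul, ← map_mul]
    rfl
  refine (splittingCocycle f).induction_on_normalizing (motive := fun s => ∃ θ : MulAut H,
    (∀ h : H, s * of (h : G) * s⁻¹ = of (θ h : G)) ∧ outProj H θ =
      outProj H f ^ (Multiplicative.toAdd ((splittingCocycle f).height s))) ?_ ?_ s hs
  · rintro _ ⟨k, rfl⟩ hk
    obtain ⟨θ, h1, h2⟩ := base k hk
    refine ⟨θ, h1, ?_⟩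
    rw [h2, (splittingCocycle f).height_of_mem ⟨_, rfl⟩, toAdd_one, zpow_zero]
  · rintro _ ⟨k, rfl⟩ hk s - ⟨θs, hs1, hs2⟩
    obtain ⟨θ, h1, h2⟩ := base k hk
    have hk0 := (splittingCocycle f).height_of_mem (k := of k) ⟨_, rfl⟩
    constructor
    · refine ⟨θ * f * θs, fun h => ?_, ?_⟩
      · rw [MulAut.mul_apply, MulAut.mul_apply, ← h1,
          equiv_eq_conj (φ := (f : H ≃* H)), ← hs1]
        simp only [mul_inv_rev, mul_assoc]
      · rw [map_mul, map_mul, h2, hs2, (splittingCocycle f).height.map_mul,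
          (splittingCocycle f).height.map_mul, hk0, SplittingCocycle.height_t, one_mul,
          one_mul, toAdd_mul, toAdd_ofAdd, zpow_add, zpow_one]
    · refine ⟨θ * f⁻¹ * θs, fun h => ?_, ?_⟩
      · rw [MulAut.mul_apply, MulAut.mul_apply, ← h1]
        have := equiv_symm_eq_conj (φ := (f : H ≃* H)) (θs h)
        change (of ((f⁻¹ (θs h) : H) : G) : HNNExtension G H H f) = _ at this
        rw [this, ← hs1]
        simp only [mul_inv_rev, mul_assoc, inv_inv]
      · rw [map_mul, map_mul, h2, hs2, (splittingCocycle f).height.map_mul,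
          (splittingCocycle f).height.map_mul, hk0, (splittingCocycle f).height.map_inv, map_inv,
          SplittingCocycle.height_t, one_mul, one_mul, toAdd_mul, toAdd_inv, toAdd_ofAdd,
          zpow_add, zpow_neg_one]

theorem outProj_of_mulEquiv (hG : IsOEGroup G) [Finite H]
    (hcentral : autTilde H ≤ Subgroup.center (Out H))
    (e : HNNExtension G H H f ≃* HNNExtension G H H f') :
    outProj H f = outProj H f' ∨ outProj H f = (outProj H f')⁻¹ := by
  obtain ⟨e, a, haH, ha⟩ := exists_mulEquiv_autStabilizer hG e
  have haH' : H.map a.toMonoidHom = H := haH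
  let β : MulAut H := (a.subgroupMap H).trans (MulEquiv.subgroupCongr haH')
  have hβ : ∀ h : H, a (h : G) = (β h : G) := fun h => rfl
  -- Apply e to the defining relation; comparison with `exists_conj_eq` in the target gives the
  -- result.
  have hconj : ∀ h : H, e t * of (h : G) * (e t)⁻¹ = of ((β * f * β⁻¹) h : G) := by
    intro h
    have h1 : (h : G) = a ((β⁻¹ h : H) : G) := by
      rw [hβ]; exact congrArg Subtype.val (β.apply_symm_apply h).symm
    rw [h1, ← ha, ← map_mul, ← map_inv, ← map_mul, ← equiv_eq_conj (φ := (f : H ≃* H)), ha, hβ]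
    rfl
  obtain ⟨θ, h1, h2⟩ := exists_conj_eq (e t) (by
    rintro _ ⟨h, hh, rfl⟩
    rw [hconj ⟨h, hh⟩]
    exact Subgroup.mem_map_of_mem _ (Subtype.property _))
  have hθ : θ = β * f * β⁻¹ := by
    ext h
    apply of_injective f'
    rw [← h1, hconj]
  rw [← outProj_conj H hcentral ⟨a, haH, hβ⟩ f, ← hθ, h2]
  rcases height_apply_t e a ha with h | h <;> rw [h]
  · left; rw [toAdd_ofAdd, zpow_one]
  · right; rw [toAdd_ofAdd, zpow_neg_one]

end HNNExtension

theorem mainTheorem12 {G₁ : Type*} [Group G₁] (hG₁ : IsOEGroup G₁)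
    (H : Subgroup G₁) [Finite H]
    (hcentral : autTilde H ≤ Subgroup.center (Out H)) :
    ∃ _ : (normalizerTilde H).Normal,
      (numHNNClasses H : ℚ) =
        ((Nat.card (Out H ⧸ normalizerTilde H) : ℚ) +
          (Nat.card {q : Out H ⧸ normalizerTilde H // orderOf q ≤ 2} : ℚ)) / 2 := by
  have hN := normalizerTilde_normal H hcentral
  refine ⟨hN, ?_⟩
  have : Finite (MulAut H) := Finite.of_injective (fun f : MulAut H => (f : H → H))
    DFunLike.coe_injective
  have : Finite (Out H ⧸ normalizerTilde H) := Finite.of_surjective _ (outProj_surjective H)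
  exact card_quotient_eq_of_iff_eq_or_eq_inv (hnnSetoid H) (outProj H) (outProj_surjective H)
    fun f f' => ⟨fun ⟨e⟩ => HNNExtension.outProj_of_mulEquiv hG₁ hcentral e,
      HNNExtension.nonempty_mulEquiv_of_outProj⟩
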